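/- Conventions. All rings are associative and unital (not necessarily commutative), and subrings share the identity. A proper subring $R$ of a ring $T$ is a maximal subring if there is no subring strictly between $R$ and $T$. "Ideal" means two-sided ideal; a maximal ideal is a proper ideal that is maximal among proper ideals; a proper ideal $P$ of a ring $A$ is prime if $aAb\subseteq P$ implies $a\in P$ or $b\in P$. $Spec(A)$ and $Max(A)$ are the sets of prime and of maximal ideals of $A$; $A$ is zero-dimensional if the supremum of the lengths of chains of prime ideals of $A$ is $0$. $J(A)$ is the Jacobson radical, $Nil_*(A)$ the lower nilradical (the intersection of all prime ideals), $Nil^*(A)$ the upper nilradical (the sum of all nil ideals). For a subring $R$ of $T$, $(R:T)=\{x\in T : TxT\subseteq R\}$. A ring $A$ is semiprimary if $A/J(A)$ is semisimple Artinian and $J(A)$ is nilpotent. Theorem. Let $T$ be a left Artinian ring and $R$ a maximal subring of $T$. Then exactly one of the following holds. (1) There is a maximal ideal $M$ of $T$ with $M\subseteq R$. It is the unique maximal ideal of $T$ contained in $R$; $R/M$ is a maximal subring of $T/M$, which is a simple left Artinian ring, isomorphic to $\mathbb{M}_n(D)$ for some $n\ge 1$ and some division ring $D$; $(R:T)=M$;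 and each prime ideal of $R$ either contains $M$ or is a maximal ideal of $R$. (2) $R$ contains no maximal ideal of $T$; $R$ is zero-dimensional; $Spec(R)$ is finite with $|Spec(R)|\le|Max(T)|$; $J(R)=Nil^*(R)=Nil_*(R)=J(T)\cap R$ is a nilpotent ideal of $R$; and at least one of the following holds: (a) there are maximal ideals $M\ne N$ of $T$ with $T/M\cong T/N$ as rings; (b) $R/J(R)\cong T/J(T)$ as rings, and $R$ is a semiprimary ring. -/

import Mathlib

universe u

namespace MaximalSubring

/-- A prime (two-sided, proper) ideal of a possibly noncommutative ring:
`a A b ⊆ P` implies `a ∈ P` or `b ∈ P`. (Mathlib's `Ideal.IsPrime` is the notion of a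
completely prime left ideal, which is different for noncommutative rings.) -/
structure IsPrimeIdeal {A : Type*} [Ring A] (P : Ideal A) : Prop where
  isTwoSided : P.IsTwoSided
  ne_top : P ≠ ⊤
  mem_or_mem : ∀ a b : A, (∀ r : A, a * r * b ∈ P) → a ∈ P ∨ b ∈ P

/-- A maximal ideal: a proper two-sided ideal which is maximal among the proper two-sided
ideals. (Mathlib's `Ideal.IsMaximal` is maximality among left ideals.) -/
structure IsMaximalIdeal {A : Type*} [Ring A] (M : Ideal A) : Prop where
  isTwoSided : M.IsTwoSided
  ne_top : M ≠ ⊤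
  eq_top_of_lt : ∀ I : Ideal A, I.IsTwoSided → M < I → I = ⊤

/-- The set `Spec(A)` of all prime ideals of `A`. -/
def spec (A : Type*) [Ring A] : Set (Ideal A) := {P | IsPrimeIdeal P}

/-- The set `Max(A)` of all maximal ideals of `A`. -/
def maxSpec (A : Type*) [Ring A] : Set (Ideal A) := {M | IsMaximalIdeal M}

/-- The classical Krull dimension of `A`: the supremum of the lengths of all chains of prime
ideals of `A`. -/
noncomputable def classicalKrullDim (A : Type*) [Ring A] : WithBot ℕ∞ :=
  Order.krullDim (spec A)

/-- The lower nilradical `Nil_*(A)`: the intersection of all prime ideals of `A`. -/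
def lowerNilradical (A : Type*) [Ring A] : Ideal A := sInf (spec A)

/-- The upper nilradical `Nil^*(A)`: the sum of all nil (two-sided) ideals of `A`. -/
def upperNilradical (A : Type*) [Ring A] : Ideal A :=
  sSup {I : Ideal A | I.IsTwoSided ∧ ∀ x ∈ I, IsNilpotent x}

/-- The conductor `(R : T) = {x ∈ T | T x T ⊆ R}` of a subring `R` of `T`. -/
def conductor {T : Type*} [Ring T] (R : Subring T) : Ideal T where
  carrier := {x | ∀ a b : T, a * x * b ∈ R}
  add_mem' hx hy a b := by
    rw [mul_add, add_mul]
    exact R.add_mem (hx a b) (hy a b)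
  zero_mem' a b := by simp
  smul_mem' c x hx a b := by
    rw [smul_eq_mul, ← mul_assoc]
    exact hx (a * c) b

end MaximalSubring

/-! For a two-sided ideal `I` of `T` not inside `R`, maximality gives `R + I = T`, so `R/(I ∩ R) ≅
T/I` (`exists_sub_mem_of_not_subset`).

Case (1): the conductor is the largest ideal of `T` inside `R`, so it equals any maximal `M ⊆ R`. A
prime `P` of `R` not containing `M` is the contraction of the prime `{t | M t M ⊆ P}` of `T`. Primes
of `T` are maximal, and `M ⊆ R` makes `R` surject onto the quotient, so `P` is maximal.

Case (2): every maximal ideal of `T` contracts to a maximal ideal of `R`. Finitely many such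
contractions intersect in the nilpotent ideal `J(T) ∩ R`, so they are all the primes of `R`. If
`J(T)` is not inside `R`, then `R + J(T) = T` gives (b). Otherwise `finset_inf_not_subset` forces
two distinct maximal ideals to share a contraction, and both residue rings are the same quotient of
`R`, giving (a). -/

namespace MaximalSubring

/-! ### Prime and maximal two-sided ideals of a general ring. -/

section TwoSided

variable {A : Type*} [Ring A]

theorem isTwoSided_sup {I J : Ideal A} (hI : I.IsTwoSided) (hJ : J.IsTwoSided) :
    (I ⊔ J).IsTwoSided := by
  refine ⟨fun {a} b ha => ?_⟩
  obtain ⟨x, hx, y, hy, rfl⟩ := Submodule.mem_sup.1 ha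
  rw [add_mul]
  exact Submodule.add_mem_sup (I.mul_mem_right b hx) (J.mul_mem_right b hy)

theorem isTwoSided_finset_inf {ι : Type*} (s : Finset ι) (f : ι → Ideal A)
    (h : ∀ i ∈ s, (f i).IsTwoSided) : (s.inf f).IsTwoSided := by
  refine ⟨fun {a} b ha => ?_⟩
  simp only [Submodule.mem_finsetInf] at ha ⊢
  intro i hi
  have := h i hi
  exact (f i).mul_mem_right b (ha i hi)

/-- The two-sided ideal `{x | x A b ⊆ I}`. -/
def annihilatorMod (I : Ideal A) [I.IsTwoSided] (b : A) : Ideal A where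
  carrier := {x | ∀ r, x * r * b ∈ I}
  add_mem' hx hy r := by
    rw [add_mul, add_mul]
    exact I.add_mem (hx r) (hy r)
  zero_mem' r := by simp
  smul_mem' c x hx r := by
    rw [smul_eq_mul, mul_assoc c, mul_assoc c]
    exact I.mul_mem_left c (hx r)

instance annihilatorMod_isTwoSided (I : Ideal A) [I.IsTwoSided] (b : A) :
    (annihilatorMod I b).IsTwoSided where
  mul_mem_of_left {a} c ha r := by
    rw [mul_assoc a]
    exact ha (c * r)

theorem IsMaximalIdeal.one_notMem {M : Ideal A} (hM : IsMaximalIdeal M) : (1 : A) ∉ M :=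
  fun h => hM.ne_top ((Ideal.eq_top_iff_one _).2 h)

theorem IsMaximalIdeal.eq_of_le {M N : Ideal A} (hM : IsMaximalIdeal M) (hN : IsMaximalIdeal N)
    (h : M ≤ N) : M = N :=
  h.eq_of_not_lt fun hlt => hN.ne_top (hM.eq_top_of_lt N hN.isTwoSided hlt)

theorem IsMaximalIdeal.sup_eq_top {M I : Ideal A} (hM : IsMaximalIdeal M) (hI : I.IsTwoSided)
    (h : ¬ I ≤ M) : I ⊔ M = ⊤ :=
  hM.eq_top_of_lt _ (isTwoSided_sup hI hM.isTwoSided) (right_lt_sup.2 h)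

theorem IsMaximalIdeal.isPrimeIdeal {M : Ideal A} (hM : IsMaximalIdeal M) : IsPrimeIdeal M := by
  have := hM.isTwoSided
  refine ⟨hM.isTwoSided, hM.ne_top, fun a b hab => or_iff_not_imp_right.2 fun hb => ?_⟩
  by_contra ha
  have hle : M ≤ annihilatorMod M b := fun x hx r =>
    M.mul_mem_right b (M.mul_mem_right r hx)
  have htop := hM.eq_top_of_lt _ (annihilatorMod_isTwoSided M b)
    (lt_of_le_of_ne hle fun h => ha (h.symm ▸ (show a ∈ annihilatorMod M b from hab)))
  have h1 : (1 : A) ∈ annihilatorMod M b := htop ▸ Submodule.mem_top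
  exact hb (by simpa using h1 1)

theorem IsMaximalIdeal.isSimpleRing_quotient {M : Ideal A} [M.IsTwoSided]
    (hM : IsMaximalIdeal M) : IsSimpleRing (A ⧸ M) := by
  refine isSimpleRing_iff_isTwoSided_imp.2
    ⟨Ideal.Quotient.nontrivial_iff.2 hM.ne_top, fun I hI => or_iff_not_imp_left.2 fun hne => ?_⟩
  obtain ⟨y, hy, hy0⟩ := Submodule.exists_mem_ne_zero_of_ne_bot hne
  obtain ⟨x, rfl⟩ := Ideal.Quotient.mk_surjective y
  have hlt : M < I.comap (Ideal.Quotient.mk M) := by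
    refine lt_of_le_of_ne (fun z hz => ?_) fun h => hy0 ?_
    · rw [Ideal.mem_comap, Ideal.Quotient.eq_zero_iff_mem.2 hz]
      exact I.zero_mem
    · rw [Ideal.Quotient.eq_zero_iff_mem, h]
      exact hy
  have h := hM.eq_top_of_lt _ inferInstance hlt
  rw [Ideal.eq_top_iff_one, Ideal.mem_comap, map_one] at h
  exact (Ideal.eq_top_iff_one _).2 h

/-- `J` may be a mere left ideal; this is needed for complements in the left module `T/J(T)`. -/
theorem IsPrimeIdeal.le_or_le_of_inf_le {P I J : Ideal A} (hP : IsPrimeIdeal P)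
    (hI : I.IsTwoSided) (h : I ⊓ J ≤ P) : I ≤ P ∨ J ≤ P := by
  by_contra! hne
  obtain ⟨a, ha, haP⟩ := SetLike.not_le_iff_exists.1 hne.1
  obtain ⟨b, hb, hbP⟩ := SetLike.not_le_iff_exists.1 hne.2
  rcases hP.mem_or_mem a b fun r =>
    h ⟨I.mul_mem_right b (I.mul_mem_right r ha), J.mul_mem_left _ hb⟩ with h | h
  exacts [haP h, hbP h]

theorem IsPrimeIdeal.exists_le_of_finset_inf_le {ι : Type*} {P : Ideal A} (hP : IsPrimeIdeal P)
    (s : Finset ι) (f : ι → Ideal A) (hs : ∀ i ∈ s, (f i).IsTwoSided) (h : s.inf f ≤ P) :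
    ∃ i ∈ s, f i ≤ P := by
  classical
  induction s using Finset.induction_on with
  | empty => exact absurd (top_le_iff.1 h) hP.ne_top
  | insert j s _ ih =>
    rw [Finset.inf_insert] at h
    rcases hP.le_or_le_of_inf_le (hs j (Finset.mem_insert_self j s)) h with h | h
    · exact ⟨j, Finset.mem_insert_self j s, h⟩
    · obtain ⟨i, hi, hle⟩ := ih (fun i hi => hs i (Finset.mem_insert_of_mem hi)) h
      exact ⟨i, Finset.mem_insert_of_mem hi, hle⟩

theorem IsPrimeIdeal.le_of_pow_le {P I : Ideal A} (hP : IsPrimeIdeal P) [I.IsTwoSided] (n : ℕ)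
    (h : I ^ n ≤ P) : I ≤ P := by
  induction n with
  | zero =>
    rw [Submodule.pow_zero, Ideal.one_eq_top, top_le_iff] at h
    exact absurd h hP.ne_top
  | succ n ih =>
    by_contra hI
    obtain ⟨a, ha, haP⟩ := SetLike.not_le_iff_exists.1 (mt ih hI)
    obtain ⟨b, hb, hbP⟩ := SetLike.not_le_iff_exists.1 hI
    rcases hP.mem_or_mem a b fun r => h (by
      rw [Submodule.pow_succ]
      exact Ideal.mul_mem_mul (Ideal.mul_mem_right r _ ha) hb) with h | h
    exacts [haP h, hbP h]

theorem IsPrimeIdeal.le_of_isNilpotent {P I : Ideal A} (hP : IsPrimeIdeal P) [I.IsTwoSided]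
    (h : IsNilpotent I) : I ≤ P := by
  obtain ⟨n, hn⟩ := h
  exact hP.le_of_pow_le n (hn.trans_le bot_le)

theorem IsMaximalIdeal.jacobson_le {M : Ideal A} (hM : IsMaximalIdeal M) :
    Ring.jacobson A ≤ M := by
  obtain ⟨m, hm, hle⟩ := Ideal.exists_le_maximal M hM.ne_top
  by_contra h
  have htop := hM.sup_eq_top (inferInstanceAs (Ring.jacobson A).IsTwoSided) h
  exact hm.ne_top (top_le_iff.1 (htop ▸ sup_le (Ring.jacobson_le_of_isMaximal m) hle))

theorem le_jacobson_of_nil {I : Ideal A} (h : ∀ x ∈ I, IsNilpotent x) :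
    I ≤ Ring.jacobson A := by
  intro x hx
  rw [← Ideal.jacobson_bot, Ideal.mem_jacobson_iff]
  intro y
  obtain ⟨z, hz⟩ := (h _ (I.mul_mem_left y hx)).isUnit_one_add.exists_left_inv
  refine ⟨z, ?_⟩
  rw [Ideal.mem_bot, ← hz]
  noncomm_ring

theorem isNilpotent_of_mem {I : Ideal A} (hI : IsNilpotent I) {x : A} (hx : x ∈ I) :
    IsNilpotent x := by
  obtain ⟨n, hn⟩ := hI
  exact ⟨n, by simpa [hn] using Ideal.pow_mem_pow hx n⟩

/-- Primitive ideals are prime: if `b` does not kill the simple module `A/m`, some `b t` generates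
it, so `a A b` killing it forces `a` to kill it. -/
theorem IsPrimeIdeal.of_isMaximal_annihilator {m : Ideal A} (hm : m.IsMaximal) :
    IsPrimeIdeal (Module.annihilator A (A ⧸ m)) := by
  have mem : ∀ x, x ∈ Module.annihilator A (A ⧸ m) ↔ ∀ t : A, x * t ∈ m := fun x => by
    rw [Module.mem_annihilator]
    refine ⟨fun h t => ?_, fun h q => ?_⟩
    · exact (Submodule.Quotient.mk_eq_zero m).1 (h (Submodule.Quotient.mk t))
    · obtain ⟨t, rfl⟩ := Submodule.Quotient.mk_surjective m q
      exact (Submodule.Quotient.mk_eq_zero m).2 (h t)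
  refine ⟨inferInstance, fun h => hm.ne_top ?_, fun a b hab => or_iff_not_imp_right.2 fun hb => ?_⟩
  · rw [Ideal.eq_top_iff_one, mem] at h
    rw [Ideal.eq_top_iff_one]
    simpa using h 1
  · simp only [mem] at hab hb ⊢
    push Not at hb
    obtain ⟨t, ht⟩ := hb
    intro x
    obtain ⟨y, z, hz, hyz⟩ := hm.exists_inv ht
    have : a * x = a * (x * y) * b * t + a * x * z := by
      calc a * x = a * x * (y * (b * t) + z) := by rw [hyz, mul_one]
        _ = _ := by noncomm_ring
    rw [this]
    exact m.add_mem (hab _ _) (m.mul_mem_left _ hz)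

/-- `hf` says that `A` surjects onto the simple ring `B/M`, so an ideal above the kernel has image
zero or everything. -/
theorem IsMaximalIdeal.comap {B : Type*} [Ring B] (f : A →+* B) {M : Ideal B}
    (hM : IsMaximalIdeal M) (hf : ∀ b, ∃ a, b - f a ∈ M) : IsMaximalIdeal (M.comap f) := by
  have := hM.isTwoSided
  refine ⟨inferInstance, fun h => hM.one_notMem ?_, fun I hI hlt => ?_⟩
  · simpa using (Ideal.eq_top_iff_one _).1 h
  obtain ⟨x, hxI, hxM⟩ := SetLike.exists_of_lt hlt
  have hsurj : Function.Surjective ((Ideal.Quotient.mk M).comp f) := fun q => by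
    obtain ⟨b, rfl⟩ := Ideal.Quotient.mk_surjective q
    obtain ⟨a, ha⟩ := hf b
    exact ⟨a, ((Ideal.Quotient.mk_eq_mk_iff_sub_mem _ _).2 ha).symm⟩
  have : RingHomSurjective ((Ideal.Quotient.mk M).comp f) := ⟨hsurj⟩
  have hsimple := (isSimpleRing_iff_isTwoSided_imp.1 hM.isSimpleRing_quotient).2
    (I.map ((Ideal.Quotient.mk M).comp f)) inferInstance
  rcases hsimple with h | h
  · have hx := Ideal.mem_map_of_mem ((Ideal.Quotient.mk M).comp f) hxI
    rw [h, Ideal.mem_bot] at hx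
    exact absurd (Ideal.Quotient.eq_zero_iff_mem.1 hx) hxM
  · rw [Ideal.eq_top_iff_one, Ideal.mem_map_iff_of_surjective _ hsurj] at h
    obtain ⟨i, hi, h1⟩ := h
    rw [Ideal.eq_top_iff_one]
    have hmem : 1 - i ∈ M.comap f := by
      rw [Ideal.mem_comap, ← Ideal.Quotient.eq_zero_iff_mem, map_sub, map_sub, map_one, map_one,
        sub_eq_zero]
      exact h1.symm
    simpa using I.add_mem (hlt.le hmem) hi

/-- If `A` surjects onto `B ⧸ I` then `A ⧸ f⁻¹ I` is isomorphic to `B ⧸ I`. -/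
theorem nonempty_quotient_comap_ringEquiv {B : Type*} [Ring B] (f : A →+* B) (I : Ideal B)
    [I.IsTwoSided] (hf : ∀ b, ∃ a, b - f a ∈ I) :
    Nonempty ((A ⧸ I.comap f) ≃+* (B ⧸ I)) := by
  have hsurj : Function.Surjective ((Ideal.Quotient.mk I).comp f) := fun q => by
    obtain ⟨b, rfl⟩ := Ideal.Quotient.mk_surjective q
    obtain ⟨a, ha⟩ := hf b
    exact ⟨a, ((Ideal.Quotient.mk_eq_mk_iff_sub_mem _ _).2 ha).symm⟩
  have hker : I.comap f = RingHom.ker ((Ideal.Quotient.mk I).comp f) := by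
    ext x
    simp [RingHom.mem_ker, Ideal.Quotient.eq_zero_iff_mem]
  exact ⟨(Ideal.quotEquivOfEq hker).trans (RingHom.quotientKerEquivOfSurjective hsurj)⟩

theorem isNilpotent_of_le_comap {B : Type*} [Ring B] (f : A →+* B) (hf : Function.Injective f)
    {I : Ideal A} {J : Ideal B} (h : I ≤ J.comap f) (hJ : IsNilpotent J) : IsNilpotent I := by
  have hpow : ∀ n, I ^ n ≤ (J ^ n).comap f := fun n => by
    induction n with
    | zero => simp [Submodule.pow_zero, Ideal.one_eq_top]
    | succ n ih =>
      rw [Submodule.pow_succ, Submodule.pow_succ, Ideal.mul_le]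
      intro r hr s hs
      rw [Ideal.mem_comap, map_mul]
      exact Ideal.mul_mem_mul (ih hr) (h hs)
  obtain ⟨n, hn⟩ := hJ
  refine ⟨n, (Submodule.eq_bot_iff _).2 fun x hx => hf ?_⟩
  have := hpow n hx
  rw [hn] at this
  simpa using this

end TwoSided

/-! ### Primes, maximal ideals and the radical of an Artinian ring. -/

section Artinian

variable {T : Type*} [Ring T] [IsArtinianRing T]

theorem isNilpotent_jacobson : IsNilpotent (Ring.jacobson T) :=
  IsSemiprimaryRing.isNilpotent

theorem exists_complement_mod_jacobson (I : Ideal T) :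
    ∃ K : Ideal T, I ⊔ K = ⊤ ∧ I ⊓ K ≤ Ring.jacobson T := by
  obtain ⟨K, hK⟩ := exists_isCompl (I.map (Ideal.Quotient.mk (Ring.jacobson T)))
  refine ⟨K.comap (Ideal.Quotient.mk _), ?_, fun x hx => ?_⟩
  · have h1 : (1 : T ⧸ Ring.jacobson T) ∈ I.map (Ideal.Quotient.mk (Ring.jacobson T)) ⊔ K :=
      hK.sup_eq_top ▸ Submodule.mem_top
    obtain ⟨y, hy, z, hz, hyz⟩ := Submodule.mem_sup.1 h1
    obtain ⟨i, hi, rfl⟩ :=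
      (Ideal.mem_map_iff_of_surjective _ Ideal.Quotient.mk_surjective).1 hy
    refine (Ideal.eq_top_iff_one _).2 (Submodule.mem_sup.2 ⟨i, hi, 1 - i, ?_, by abel⟩)
    rw [Ideal.mem_comap, map_sub, map_one, ← hyz, add_sub_cancel_left]
    exact hz
  · have : Ideal.Quotient.mk (Ring.jacobson T) x ∈
        I.map (Ideal.Quotient.mk (Ring.jacobson T)) ⊓ K :=
      ⟨Ideal.mem_map_of_mem _ hx.1, hx.2⟩
    rw [hK.inf_eq_bot, Submodule.mem_bot] at this
    exact Ideal.Quotient.eq_zero_iff_mem.1 this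

/-- For `I > P`, a complement `K` of `I` modulo `J(T)` has `I ∩ K ≤ J(T) ≤ P`, so `K ≤ P < I` and
`I` is everything. -/
theorem IsPrimeIdeal.isMaximalIdeal {P : Ideal T} (hP : IsPrimeIdeal P) : IsMaximalIdeal P := by
  refine ⟨hP.isTwoSided, hP.ne_top, fun I hI hlt => ?_⟩
  have hJ : Ring.jacobson T ≤ P := hP.le_of_isNilpotent isNilpotent_jacobson
  obtain ⟨K, hsup, hinf⟩ := exists_complement_mod_jacobson I
  rcases hP.le_or_le_of_inf_le hI (hinf.trans hJ) with h | h
  · exact absurd h hlt.not_ge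
  · rw [← hsup, sup_eq_left.2 (h.trans hlt.le)]

theorem jacobson_eq_sInf_maxSpec : Ring.jacobson T = sInf (maxSpec T) := by
  refine le_antisymm (le_sInf fun M hM => hM.jacobson_le) ?_
  rw [Ring.jacobson_eq_sInf_isMaximal]
  refine le_sInf fun m hm => ?_
  refine (sInf_le (IsPrimeIdeal.of_isMaximal_annihilator hm).isMaximalIdeal).trans fun x hx => ?_
  simpa using (Submodule.Quotient.mk_eq_zero m).1
    (Module.mem_annihilator.1 hx (Submodule.Quotient.mk 1))

theorem finite_maxSpec : (maxSpec T).Finite := by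
  classical
  -- A minimal finite intersection lies in every maximal ideal, which by primality must then be one
  -- of its members.
  obtain ⟨I, ⟨s, hs, rfl⟩, hmin⟩ := IsArtinian.set_has_minimal
    {I : Ideal T | ∃ s : Finset (Ideal T), (∀ M ∈ s, IsMaximalIdeal M) ∧ s.inf id = I}
    ⟨⊤, ∅, by simp, by simp⟩
  refine s.finite_toSet.subset fun M hM => ?_
  have hle : s.inf id ≤ M := by
    by_contra h
    refine hmin _ ⟨insert M s, fun N hN => ?_, rfl⟩ ?_
    · rcases Finset.mem_insert.1 hN with rfl | hN
      exacts [hM, hs N hN]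
    · rw [Finset.inf_insert]
      exact inf_lt_right.2 h
  obtain ⟨N, hN, hNM⟩ := hM.isPrimeIdeal.exists_le_of_finset_inf_le s id
    (fun N hN => (hs N hN).isTwoSided) hle
  exact (hs N hN).eq_of_le hM hNM ▸ hN

end Artinian

/-! ### Ideals of `T` relative to a maximal subring. -/

section Coatom

variable {T : Type*} [Ring T] {R : Subring T}

/-- The preimage of the image of `R` in `T/I` is the subring `R + I`, strictly larger than `R`. -/
theorem exists_sub_mem_of_not_subset (hR : IsCoatom R) (I : Ideal T) [I.IsTwoSided]
    (hI : ¬ (I : Set T) ⊆ R) (t : T) : ∃ r : R, t - R.subtype r ∈ I := by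
  have hle : R ≤ (R.map (Ideal.Quotient.mk I)).comap (Ideal.Quotient.mk I) :=
    fun r hr => ⟨r, hr, rfl⟩
  obtain ⟨x, hxI, hxR⟩ := Set.not_subset.1 hI
  have htop := hR.2 _ (lt_of_le_of_ne hle fun h => hxR (by
    rw [h]
    exact ⟨0, R.zero_mem, by rw [map_zero, Ideal.Quotient.eq_zero_iff_mem.2 hxI]⟩))
  have ht : t ∈ (R.map (Ideal.Quotient.mk I)).comap (Ideal.Quotient.mk I) :=
    htop ▸ Subring.mem_top t
  obtain ⟨r, hr, hrt⟩ := ht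
  exact ⟨⟨r, hr⟩, (Ideal.Quotient.mk_eq_mk_iff_sub_mem _ _).1 hrt.symm⟩

theorem isCoatom_map_mk (hR : IsCoatom R) (I : Ideal T) [I.IsTwoSided]
    (hI : (I : Set T) ⊆ R) : IsCoatom (R.map (Ideal.Quotient.mk I)) := by
  have hcomap : (R.map (Ideal.Quotient.mk I)).comap (Ideal.Quotient.mk I) = R := by
    refine le_antisymm ?_ fun r hr => ⟨r, hr, rfl⟩
    rintro t ⟨r, hr, hrt⟩
    have h := hI ((Ideal.Quotient.mk_eq_mk_iff_sub_mem _ _).1 hrt.symm)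
    simpa using R.add_mem h hr
  refine ⟨fun h => hR.1 ?_, fun S hS => ?_⟩
  · rw [← hcomap, h, Subring.comap_top]
  · have hlt : R < S.comap (Ideal.Quotient.mk I) := by
      refine lt_of_le_of_ne (fun r hr => hS.le ⟨r, hr, rfl⟩) fun h => hS.not_ge fun q hq => ?_
      obtain ⟨t, rfl⟩ := Ideal.Quotient.mk_surjective q
      exact ⟨t, by rw [h]; exact hq, rfl⟩
    refine eq_top_iff.2 fun q _ => ?_
    obtain ⟨t, rfl⟩ := Ideal.Quotient.mk_surjective q
    exact (hR.2 _ hlt).ge (Subring.mem_top t)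

/-- Maximal ideals of `T` not contained in `R` whose traces on `R` are pairwise distinct
have an intersection that is not contained in `R`. -/
theorem finset_inf_not_subset (hR : IsCoatom R) (s : Finset (Ideal T))
    (hs : ∀ M ∈ s, IsMaximalIdeal M ∧ ¬ (M : Set T) ⊆ R)
    (hinj : Set.InjOn (Ideal.comap R.subtype) s) : ¬ ((s.inf id : Ideal T) : Set T) ⊆ R := by
  classical
  induction s using Finset.induction_on with
  | empty =>
    intro h
    exact hR.1 (eq_top_iff.2 fun t _ => h (by simp))
  | insert M s hMs ih =>
    have hs' : ∀ N ∈ s, IsMaximalIdeal N ∧ ¬ (N : Set T) ⊆ R :=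
      fun N hN => hs N (Finset.mem_insert_of_mem hN)
    obtain ⟨x, hxA, hxR⟩ := Set.not_subset.1
      (ih hs' (hinj.mono (Finset.coe_subset.2 (Finset.subset_insert M s))))
    obtain ⟨hM, hMR⟩ := hs M (Finset.mem_insert_self M s)
    have := hM.isTwoSided
    have hAts : (s.inf id : Ideal T).IsTwoSided :=
      isTwoSided_finset_inf s id fun N hN => (hs' N hN).1.isTwoSided
    intro hsub
    rw [Finset.inf_insert, id] at hsub
    have hMc := hM.comap R.subtype (exists_sub_mem_of_not_subset hR M hMR)
    -- With `A` the intersection over `s`: if `A ∩ R ≤ M ∩ R`, primality puts some `N ∩ R` below `M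
    -- ∩ R`, hence equal to it, against injectivity. Otherwise `A ∩ R` and `M ∩ R` are comaximal in
    -- `R`.
    by_cases hle : (s.inf id : Ideal T).comap R.subtype ≤ M.comap R.subtype
    · have hinf : s.inf (Ideal.comap R.subtype) ≤ M.comap R.subtype := by
        refine le_trans (fun r hr => ?_) hle
        rw [Ideal.mem_comap, Submodule.mem_finsetInf]
        exact fun N hN => Submodule.mem_finsetInf.1 hr N hN
      obtain ⟨N, hN, hNM⟩ := hMc.isPrimeIdeal.exists_le_of_finset_inf_le s _
        (fun N hN => have := (hs' N hN).1.isTwoSided; inferInstance) hinf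
      have hNts := (hs' N hN).1.isTwoSided
      have hNc := (hs' N hN).1.comap R.subtype
        (exists_sub_mem_of_not_subset hR N (hs' N hN).2)
      have := hinj (Finset.mem_coe.2 (Finset.mem_insert_of_mem hN))
        (Finset.mem_coe.2 (Finset.mem_insert_self M s)) (hNc.eq_of_le hMc hNM)
      exact hMs (this ▸ hN)
    · have htop := hMc.sup_eq_top inferInstance hle
      obtain ⟨a, ha, m, hm, ham⟩ := Submodule.mem_sup.1 ((Ideal.eq_top_iff_one _).1 htop)
      have ham' : (a : T) + m = 1 := congrArg R.subtype ham
      obtain ⟨r, hr⟩ := exists_sub_mem_of_not_subset hR M hMR x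
      -- Both `x m` and `(x - r) a` lie in `A ∩ M`, assumed inside `R`; this puts `x` itself in `R`.
      have hxm : x * m ∈ R :=
        hsub ⟨M.mul_mem_left x hm, Ideal.mul_mem_right (m : T) (s.inf id) hxA⟩
      have hxa : (x - r) * a ∈ R :=
        hsub ⟨M.mul_mem_right (a : T) hr, Ideal.mul_mem_left (s.inf id) _ ha⟩
      have hx : x = (x - r) * a + r * a + x * m := by
        calc x = x * (a + m) := by rw [ham', mul_one]
          _ = _ := by noncomm_ring
      refine hxR (hx ▸ ?_)
      exact R.add_mem (R.add_mem hxa (R.mul_mem r.2 a.2)) hxm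

/-- The ideal `{t | M t M ⊆ P}` of `T` attached to an ideal `P` of `R` and a two-sided ideal
`M` of `T` contained in `R`. -/
def idealExtension (M : Ideal T) [M.IsTwoSided] (P : Ideal R) : Ideal T where
  carrier := {t | ∀ m ∈ M, ∀ n ∈ M, ∃ p ∈ P, (p : T) = m * t * n}
  add_mem' {x y} hx hy m hm n hn := by
    obtain ⟨p, hp, hpe⟩ := hx m hm n hn
    obtain ⟨q, hq, hqe⟩ := hy m hm n hn
    exact ⟨p + q, P.add_mem hp hq, by rw [Subring.coe_add, hpe, hqe, mul_add, add_mul]⟩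
  zero_mem' m _ n _ := ⟨0, P.zero_mem, by simp⟩
  smul_mem' c x hx m hm n hn := by
    obtain ⟨p, hp, hpe⟩ := hx (m * c) (M.mul_mem_right c hm) n hn
    exact ⟨p, hp, by rw [hpe, smul_eq_mul, mul_assoc m c x]⟩

instance idealExtension_isTwoSided (M : Ideal T) [M.IsTwoSided] (P : Ideal R) :
    (idealExtension M P).IsTwoSided where
  mul_mem_of_left {a} c ha m hm n hn := by
    obtain ⟨p, hp, hpe⟩ := ha m hm (c * n) (M.mul_mem_left c hn)
    exact ⟨p, hp, by rw [hpe]; noncomm_ring⟩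

/-! ### Primes of `R` not containing `M`. -/

section

variable {M : Ideal T} [M.IsTwoSided] {P : Ideal R}

theorem comap_idealExtension (hMR : (M : Set T) ⊆ R) (hP : IsPrimeIdeal P)
    (hMP : ¬ M.comap R.subtype ≤ P) : (idealExtension M P).comap R.subtype = P := by
  have := hP.isTwoSided
  obtain ⟨m₀, hm₀, hm₀P⟩ := SetLike.not_le_iff_exists.1 hMP
  refine le_antisymm (fun r hr => ?_) fun r hr m hm n hn =>
    ⟨⟨m, hMR hm⟩ * r * ⟨n, hMR hn⟩, P.mul_mem_right _ (P.mul_mem_left _ hr), rfl⟩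
  -- Sandwiching `r` between multiples of `m₀ ∉ P` lands in `P`; primality cancels `m₀` on the left,
  -- then on the right.
  have hrm : ∀ x : R, r * x * m₀ ∈ P := fun x => by
    refine (hP.mem_or_mem m₀ (r * x * m₀) fun y => ?_).resolve_left hm₀P
    obtain ⟨p, hp, hpe⟩ := hr (m₀ * y : T) (M.mul_mem_right _ hm₀) (x * m₀ : T)
      (M.mul_mem_left _ hm₀)
    have : p = m₀ * y * (r * x * m₀) := Subtype.ext (by
      rw [hpe]
      simp [mul_assoc])
    exact this ▸ hp
  exact (hP.mem_or_mem r m₀ hrm).resolve_right hm₀P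

theorem isPrimeIdeal_idealExtension (hMR : (M : Set T) ⊆ R) (hP : IsPrimeIdeal P)
    (hMP : ¬ M.comap R.subtype ≤ P) : IsPrimeIdeal (idealExtension M P) := by
  have hts := hP.isTwoSided
  have hcomap := comap_idealExtension hMR hP hMP
  refine ⟨inferInstance, fun h => hP.ne_top ?_, fun a b hab => ?_⟩
  · rw [← hcomap, h, Ideal.comap_top]
  by_contra! hne
  obtain ⟨m, hm, n, hn, ha⟩ : ∃ m, ∃ hm : m ∈ M, ∃ n, ∃ hn : n ∈ M,
      (⟨m * a * n, hMR (M.mul_mem_left _ hn)⟩ : R) ∉ P := by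
    by_contra! h
    exact hne.1 fun m hm n hn => ⟨_, h m hm n hn, rfl⟩
  obtain ⟨m', hm', n', hn', hb⟩ : ∃ m, ∃ hm : m ∈ M, ∃ n, ∃ hn : n ∈ M,
      (⟨m * b * n, hMR (M.mul_mem_left _ hn)⟩ : R) ∉ P := by
    by_contra! h
    exact hne.2 fun m hm n hn => ⟨_, h m hm n hn, rfl⟩
  refine (hP.mem_or_mem _ _ fun r => ?_).elim ha hb
  -- The inner factor `n r m'` is the arbitrary element of `T` placed between `a` and `b`.
  obtain ⟨p, hp, hpe⟩ := hab (n * r * m') m hm n' hn'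
  convert hp using 1
  refine Subtype.ext ?_
  rw [hpe]
  simp [mul_assoc]

theorem isMaximalIdeal_of_not_le [IsArtinianRing T] (hM : IsMaximalIdeal M)
    (hMR : (M : Set T) ⊆ R) (hP : IsPrimeIdeal P) (hMP : ¬ M.comap R.subtype ≤ P) :
    IsMaximalIdeal P := by
  have hcomap := comap_idealExtension hMR hP hMP
  have hQ := (isPrimeIdeal_idealExtension hMR hP hMP).isMaximalIdeal
  rw [← hcomap]
  refine hQ.comap R.subtype fun t => ?_
  have htop := hQ.sup_eq_top hM.isTwoSided fun h => hMP (by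
    rw [← hcomap]
    exact Ideal.comap_mono h)
  obtain ⟨m, hm, q, hq, rfl⟩ := Submodule.mem_sup.1 (htop ▸ Submodule.mem_top : t ∈ M ⊔ _)
  exact ⟨⟨m, hMR hm⟩, by simpa using hq⟩

end

theorem conductor_subset (R : Subring T) : (conductor R : Set T) ⊆ R := fun x hx => by
  simpa using hx 1 1

theorem le_conductor (M : Ideal T) [M.IsTwoSided] (h : (M : Set T) ⊆ R) : M ≤ conductor R :=
  fun _ hx a b => h (M.mul_mem_right b (M.mul_mem_left a hx))

instance conductor_isTwoSided (R : Subring T) : (conductor R).IsTwoSided where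
  mul_mem_of_left {x} c hx a b := by
    rw [mul_assoc, mul_assoc, ← mul_assoc a]
    exact hx a (c * b)

theorem subring_eq_top_of_ideal_eq_top {I : Ideal T} (hI : (I : Set T) ⊆ R) (h : I = ⊤) : R = ⊤ :=
  eq_top_iff.2 fun t _ => hI (by simp [h])

theorem conductor_eq (hR : IsCoatom R) {M : Ideal T} (hM : IsMaximalIdeal M)
    (hMR : (M : Set T) ⊆ R) : conductor R = M := by
  have := hM.isTwoSided
  refine ((le_conductor M hMR).eq_of_not_lt fun hlt => hR.1 ?_).symm
  exact subring_eq_top_of_ideal_eq_top (conductor_subset R)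
    (hM.eq_top_of_lt _ (conductor_isTwoSided R) hlt)

end Coatom

/-! ### Case (2): no maximal ideal of `T` lies in `R`. -/

section NoMaximalIdeal

variable {T : Type*} [Ring T] {R : Subring T}

theorem isMaximalIdeal_comap_subtype (hR : IsCoatom R)
    (hno : ∀ M : Ideal T, IsMaximalIdeal M → ¬ (M : Set T) ⊆ (R : Set T)) {M : Ideal T}
    (hM : IsMaximalIdeal M) : IsMaximalIdeal (M.comap R.subtype) := by
  have := hM.isTwoSided
  exact hM.comap R.subtype (exists_sub_mem_of_not_subset hR M (hno M hM))

variable [IsArtinianRing T]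

theorem spec_eq_image_maxSpec (hR : IsCoatom R)
    (hno : ∀ M : Ideal T, IsMaximalIdeal M → ¬ (M : Set T) ⊆ (R : Set T)) :
    spec R = Ideal.comap R.subtype '' maxSpec T := by
  refine Set.Subset.antisymm (fun P hP => ?_) ?_
  · have hnil : IsNilpotent ((Ring.jacobson T).comap R.subtype) :=
      isNilpotent_of_le_comap R.subtype Subtype.val_injective le_rfl isNilpotent_jacobson
    have hle : (finite_maxSpec (T := T)).toFinset.inf (Ideal.comap R.subtype) ≤ P := by
      refine le_trans (fun r hr => ?_) (IsPrimeIdeal.le_of_isNilpotent hP hnil)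
      rw [Ideal.mem_comap, jacobson_eq_sInf_maxSpec, Submodule.mem_sInf]
      exact fun M hM => Submodule.mem_finsetInf.1 hr M (by simpa using hM)
    obtain ⟨M, hM, hMP⟩ := IsPrimeIdeal.exists_le_of_finset_inf_le hP _ _ (fun M hM => by
      have hM' : IsMaximalIdeal M := (Set.Finite.mem_toFinset _).1 hM
      exact (isMaximalIdeal_comap_subtype hR hno hM').isTwoSided) hle
    have hM' : IsMaximalIdeal M := (Set.Finite.mem_toFinset _).1 hM
    have hMc := isMaximalIdeal_comap_subtype hR hno hM'
    refine ⟨M, hM', hMP.eq_of_not_lt fun hlt => ?_⟩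
    exact hP.ne_top (hMc.eq_top_of_lt P hP.isTwoSided hlt)
  · rintro _ ⟨M, hM, rfl⟩
    exact (isMaximalIdeal_comap_subtype hR hno hM).isPrimeIdeal

theorem isMaximalIdeal_of_mem_spec (hR : IsCoatom R)
    (hno : ∀ M : Ideal T, IsMaximalIdeal M → ¬ (M : Set T) ⊆ (R : Set T)) {P : Ideal R}
    (hP : P ∈ spec R) : IsMaximalIdeal P := by
  rw [spec_eq_image_maxSpec hR hno] at hP
  obtain ⟨M, hM, rfl⟩ := hP
  exact isMaximalIdeal_comap_subtype hR hno hM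

theorem lowerNilradical_eq (hR : IsCoatom R)
    (hno : ∀ M : Ideal T, IsMaximalIdeal M → ¬ (M : Set T) ⊆ (R : Set T)) :
    lowerNilradical R = (Ring.jacobson T).comap R.subtype := by
  rw [lowerNilradical, spec_eq_image_maxSpec hR hno, jacobson_eq_sInf_maxSpec]
  ext r
  simp [Submodule.mem_sInf]

theorem jacobson_eq_comap (hR : IsCoatom R)
    (hno : ∀ M : Ideal T, IsMaximalIdeal M → ¬ (M : Set T) ⊆ (R : Set T)) :
    Ring.jacobson R = (Ring.jacobson T).comap R.subtype := by
  refine le_antisymm ?_ (le_jacobson_of_nil fun x hx => isNilpotent_of_mem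
    (isNilpotent_of_le_comap R.subtype Subtype.val_injective le_rfl isNilpotent_jacobson) hx)
  rw [← lowerNilradical_eq hR hno]
  exact le_sInf fun P hP => (isMaximalIdeal_of_mem_spec hR hno hP).jacobson_le

theorem isNilpotent_jacobson_subring (hR : IsCoatom R)
    (hno : ∀ M : Ideal T, IsMaximalIdeal M → ¬ (M : Set T) ⊆ (R : Set T)) :
    IsNilpotent (Ring.jacobson R) :=
  isNilpotent_of_le_comap R.subtype Subtype.val_injective (jacobson_eq_comap hR hno).le
    isNilpotent_jacobson

theorem upperNilradical_eq_of_isNilpotent_jacobson {A : Type*} [Ring A]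
    (h : IsNilpotent (Ring.jacobson A)) : upperNilradical A = Ring.jacobson A :=
  le_antisymm (sSup_le fun _ hI => le_jacobson_of_nil hI.2)
    (le_sSup ⟨inferInstance, fun _ hx => isNilpotent_of_mem h hx⟩)

theorem classicalKrullDim_eq_zero (hR : IsCoatom R)
    (hno : ∀ M : Ideal T, IsMaximalIdeal M → ¬ (M : Set T) ⊆ (R : Set T)) :
    classicalKrullDim R = 0 := by
  -- Dimension `0` rather than `⊥` requires a prime; `T` is nontrivial because `R` is proper.
  have hne : Nonempty (spec R) := by
    rw [Set.nonempty_coe_sort, spec_eq_image_maxSpec hR hno, Set.image_nonempty]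
    by_contra h
    rw [Set.not_nonempty_iff_eq_empty] at h
    have htop : Ring.jacobson T = ⊤ := by rw [jacobson_eq_sInf_maxSpec, h, sInf_empty]
    have : Nontrivial T := by
      by_contra hT
      rw [not_nontrivial_iff_subsingleton] at hT
      exact hR.1 (eq_top_iff.2 fun t _ => Subsingleton.elim 0 t ▸ R.zero_mem)
    exact (Ring.jacobson_lt_top T).ne htop
  refine le_antisymm (Order.krullDim_nonpos_iff_forall_isMax.2 fun P Q hPQ => ?_)
    Order.krullDim_nonneg
  exact ((isMaximalIdeal_of_mem_spec hR hno P.2).eq_of_le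
    (isMaximalIdeal_of_mem_spec hR hno Q.2) hPQ).ge

theorem exists_isomorphic_quotients_of_jacobson_subset (hR : IsCoatom R)
    (hno : ∀ M : Ideal T, IsMaximalIdeal M → ¬ (M : Set T) ⊆ (R : Set T))
    (hJ : (Ring.jacobson T : Set T) ⊆ R) :
    ∃ (M N : Ideal T) (_ : M.IsTwoSided) (_ : N.IsTwoSided),
      IsMaximalIdeal M ∧ IsMaximalIdeal N ∧ M ≠ N ∧ Nonempty ((T ⧸ M) ≃+* (T ⧸ N)) := by
  have hninj : ¬ Set.InjOn (Ideal.comap R.subtype) (maxSpec T) := fun hinj => by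
    refine finset_inf_not_subset hR (finite_maxSpec (T := T)).toFinset (fun M hM => ?_)
      (by simpa using hinj) (subset_trans (fun t ht => ?_) hJ)
    · have hM' : IsMaximalIdeal M := (Set.Finite.mem_toFinset _).1 hM
      exact ⟨hM', hno M hM'⟩
    · rw [SetLike.mem_coe, jacobson_eq_sInf_maxSpec, Submodule.mem_sInf]
      exact fun M hM => Submodule.mem_finsetInf.1 ht M (by simpa using hM)
  simp only [Set.InjOn] at hninj
  push Not at hninj
  obtain ⟨M, hM, N, hN, heq, hne⟩ := hninj
  have hMts := hM.isTwoSided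
  have hNts := hN.isTwoSided
  obtain ⟨e⟩ := nonempty_quotient_comap_ringEquiv R.subtype M
    (exists_sub_mem_of_not_subset hR M (hno M hM))
  obtain ⟨e'⟩ := nonempty_quotient_comap_ringEquiv R.subtype N
    (exists_sub_mem_of_not_subset hR N (hno N hN))
  exact ⟨M, N, hMts, hNts, hM, hN, hne, ⟨(e.symm.trans (Ideal.quotEquivOfEq heq)).trans e'⟩⟩

theorem isSemiprimaryRing_of_jacobson_not_subset (hR : IsCoatom R)
    (hno : ∀ M : Ideal T, IsMaximalIdeal M → ¬ (M : Set T) ⊆ (R : Set T))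
    (hJ : ¬ (Ring.jacobson T : Set T) ⊆ R) :
    Nonempty ((R ⧸ Ring.jacobson R) ≃+* (T ⧸ Ring.jacobson T)) ∧ IsSemiprimaryRing R := by
  obtain ⟨e⟩ := nonempty_quotient_comap_ringEquiv R.subtype (Ring.jacobson T)
    (exists_sub_mem_of_not_subset hR _ hJ)
  let e' := (Ideal.quotEquivOfEq (jacobson_eq_comap hR hno)).trans e
  exact ⟨⟨e'⟩, e'.symm.isSemisimpleRing, isNilpotent_jacobson_subring hR hno⟩

end NoMaximalIdeal

end MaximalSubring

theorem mainTheorem10 {T : Type u} [Ring T] [IsArtinianRing T] (R : Subring T)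
    (hR : IsCoatom R) :
    Xor
      -- case (1)
      (∃ (M : Ideal T) (_ : M.IsTwoSided),
        (MaximalSubring.IsMaximalIdeal M ∧ (M : Set T) ⊆ (R : Set T)) ∧
        (∀ N : Ideal T, MaximalSubring.IsMaximalIdeal N → (N : Set T) ⊆ (R : Set T) → N = M) ∧
        -- `R / M` is a maximal subring of the simple Artinian ring `T / M`
        IsCoatom (R.map (Ideal.Quotient.mk M)) ∧
        IsSimpleRing (T ⧸ M) ∧
        IsArtinianRing (T ⧸ M) ∧
        (∃ (n : ℕ) (_ : n ≠ 0) (D : Type u) (_ : DivisionRing D),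
          Nonempty ((T ⧸ M) ≃+* Matrix (Fin n) (Fin n) D)) ∧
        MaximalSubring.conductor R = M ∧
        (∀ P : Ideal R, MaximalSubring.IsPrimeIdeal P →
          M.comap R.subtype ≤ P ∨ MaximalSubring.IsMaximalIdeal P))
      -- case (2)
      ((∀ M : Ideal T, MaximalSubring.IsMaximalIdeal M → ¬ (M : Set T) ⊆ (R : Set T)) ∧
        MaximalSubring.classicalKrullDim R = 0 ∧
        (MaximalSubring.spec R).Finite ∧
        (MaximalSubring.spec R).encard ≤ (MaximalSubring.maxSpec T).encard ∧
        Ring.jacobson R = MaximalSubring.upperNilradical R ∧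
        MaximalSubring.upperNilradical R = MaximalSubring.lowerNilradical R ∧
        MaximalSubring.lowerNilradical R = (Ring.jacobson T).comap R.subtype ∧
        IsNilpotent (Ring.jacobson R) ∧
        ((∃ (M N : Ideal T) (_ : M.IsTwoSided) (_ : N.IsTwoSided),
            MaximalSubring.IsMaximalIdeal M ∧ MaximalSubring.IsMaximalIdeal N ∧ M ≠ N ∧
            Nonempty ((T ⧸ M) ≃+* (T ⧸ N))) ∨
          (Nonempty ((R ⧸ Ring.jacobson R) ≃+* (T ⧸ Ring.jacobson T)) ∧
            IsSemiprimaryRing R))) := by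
  by_cases hex : ∃ M : Ideal T, MaximalSubring.IsMaximalIdeal M ∧ (M : Set T) ⊆ (R : Set T)
  · obtain ⟨M, hM, hMR⟩ := hex
    have hts := hM.isTwoSided
    have hsimple := hM.isSimpleRing_quotient
    refine Or.inl ⟨⟨M, hts, ⟨hM, hMR⟩, fun N hN hNR => ?_,
      MaximalSubring.isCoatom_map_mk hR M hMR, hsimple, inferInstance, ?_,
      MaximalSubring.conductor_eq hR hM hMR, fun P hP => or_iff_not_imp_left.2 fun h =>
        MaximalSubring.isMaximalIdeal_of_not_le hM hMR hP h⟩, fun h => h.1 M hM hMR⟩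
    · rw [← MaximalSubring.conductor_eq hR hM hMR, MaximalSubring.conductor_eq hR hN hNR]
    · obtain ⟨n, hn, D, hD, e⟩ := IsSimpleRing.exists_ringEquiv_matrix_divisionRing (T ⧸ M)
      exact ⟨n, hn.out, D, hD, e⟩
  · have hno : ∀ M : Ideal T, MaximalSubring.IsMaximalIdeal M → ¬ (M : Set T) ⊆ (R : Set T) :=
      fun M hM hMR => hex ⟨M, hM, hMR⟩
    have hspec := MaximalSubring.spec_eq_image_maxSpec hR hno
    have hnil := MaximalSubring.isNilpotent_jacobson_subring hR hno
    have hupper := MaximalSubring.upperNilradical_eq_of_isNilpotent_jacobson hnil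
    have hlower := MaximalSubring.lowerNilradical_eq hR hno
    refine Or.inr ⟨⟨hno, MaximalSubring.classicalKrullDim_eq_zero hR hno, ?_, ?_, hupper.symm, ?_,
      hlower, hnil, ?_⟩, fun ⟨M, _, h, _⟩ => hno M h.1 h.2⟩
    · rw [hspec]
      exact MaximalSubring.finite_maxSpec.image _
    · rw [hspec]
      exact Set.encard_image_le _ _
    · rw [hupper, hlower, MaximalSubring.jacobson_eq_comap hR hno]
    · by_cases hJ : (Ring.jacobson T : Set T) ⊆ R
      · exact Or.inl
          (MaximalSubring.exists_isomorphic_quotients_of_jacobson_subset hR hno hJ)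
      · exact Or.inr (MaximalSubring.isSemiprimaryRing_of_jacobson_not_subset hR hno hJ)
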